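/- Let $G=(V,V_0,V_1,E,F)$ be a finite Büchi game: $V=V_0\,\dot\cup\,V_1$ is a finite set of positions, $E\subseteq V\times V$ the set of moves, $F\subseteq V$ the target set. Player 0 moves from positions in $V_0$ and Player 1 from positions in $V_1$; an infinite play is won by Player 0 iff it visits $F$ infinitely often, and at a position without outgoing moves the player who has to move loses. Let $v\in V$, let $E^-\subseteq E$ and $E^+\subseteq V^2\setminus E$, and put $E^\pm=E^-\cup E^+$. A set $R\subseteq E^\pm$ is a *repair* if Player 0 has a winning strategy from $v$ in the game obtained from $G$ by deleting the edges in $R\cap E^-$ and adding the edges in $R\cap E^+$. For a finite set $Z$ let $\mathbb S^\infty[Z]$ be the semiring of absorptive polynomials over $Z$. Its elements are the antichains of monomials $m\colon Z\to\mathbb N\cup\{\infty\}$, where $m_1$ absorbs $m_2$ iff $m_1(x)\le m_2(x)$ for all $x$; addition and multiplication are those of polynomials (without coefficients), followed by removal of all absorbed monomials. Let $X=\{X_e\mid e\in E^\pm\}$, let $\overline X=\{\overline{X_e}\mid e\in E^\pm\}$ be a disjoint copy, and let $\mathbb S^\infty[X,\overline X]$ be the quotient of $\mathbb S^\infty[X\cup\overline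 X]$ by the congruence generated by $x\cdot\overline x=0$ for $x\in X$. The natural order, $a\le b$ iff $a+b=b$, is a complete lattice on it. Each element has a unique representative without monomials that contain both $x$ and $\overline x$ for some $x\in X$; the monomials of that representative are called its monomials. Let $\pi$ be the $\mathbb S^\infty[X,\overline X]$-interpretation with $\pi(Euw)=X_{uw}$ and $\pi(\neg Euw)=\overline{X_{uw}}$ for $uw\in E^\pm$, and with $\pi(L)=1$ or $0$ for every other literal $L$, according to whether $L$ is true or false in $G$. Let $$\mathsf{win}_0(x)=\big[\mathbf{gfp}\,Y y.\,[\mathbf{lfp}\,Z z.\,(Fz\wedge\mathrm{step}(Y,z))\vee(\neg Fz\wedge\mathrm{step}(Z,z))](y)\big](x),$$ $$\mathrm{step}(T,z)=(V_0z\wedge\exists u(Ezu\wedge Tu))\vee(V_1z\wedge\forall u(\neg Ezu\vee(Ezu\wedge Tu))),$$ and let $\pi[\![\mathsf{win}_0(v)]\!]$ be its value in semiring semantics, in which $\vee,\exists$ are read as sums, $\wedge,\forall$ as products over $V$, and $\mathbf{lfp},\mathbf{gfp}$ as least and greatest fixed points, for the natural order, of the induced operators on functions $V\to\mathbb S^\infty[X,\overline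 X]$. Put $X^\pm=\{X_e\mid e\in E^+\}\cup\{\overline{X_e}\mid e\in E^-\}$. For $Y\subseteq X^\pm$ put $E(Y)=\{e\mid X_e\in Y\text{ or }\overline{X_e}\in Y\}$, and for a monomial $m$ let $\mathsf{var}(m)$ be the set of $x\in X\cup\overline X$ with $m(x)>0$. Then: 1. For every monomial $m$ of $\pi[\![\mathsf{win}_0(v)]\!]$, the set $E(\mathsf{var}(m)\cap X^\pm)$ is a repair. 2. For every repair $R$ there is a monomial $m$ of $\pi[\![\mathsf{win}_0(v)]\!]$ with $E(\mathsf{var}(m)\cap X^\pm)\subseteq R$; if moreover $R$ is minimal (with respect to inclusion among all repairs), then $E(\mathsf{var}(m)\cap X^\pm)=R$. -/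

import Mathlib

open scoped Pointwise Classical

noncomputable section

/-! ## Büchi games, strategies, repairs -/

/-- Büchi games on the set `V` of positions. Positions without outgoing moves are allowed, because
deleting moves may create them; the player who has to move there loses (see `WinsFrom`). -/
structure BuchiGame (V : Type*) where
  V0 : Set V
  V1 : Set V
  isCompl : IsCompl V0 V1
  E : Set (V × V)
  F : Set V

namespace BuchiGame

variable {V : Type*}

/-- Nodes of the tree unraveling from `v₀`: the nonempty finite paths that start in `v₀`. -/
def IsPathFrom (G : BuchiGame V) (v₀ : V) (ρ : List V) : Prop :=
  ρ.head? = some v₀ ∧ List.IsChain (fun a b => (a, b) ∈ G.E) ρ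

/-- `W` is the node set of a strategy tree of Player 0 from `v₀`. -/
structure IsStrategy (G : BuchiGame V) (v₀ : V) (W : Set (List V)) : Prop where
  root_mem : [v₀] ∈ W
  isPath : ∀ ρ ∈ W, G.IsPathFrom v₀ ρ
  prefix_closed : ∀ (ρ : List V) (v : V), ρ ≠ [] → ρ ++ [v] ∈ W → ρ ∈ W
  unique_choice : ∀ (ρ : List V) (v : V), ρ ++ [v] ∈ W → v ∈ G.V0 →
    ∃! w, (v, w) ∈ G.E ∧ ρ ++ [v, w] ∈ W
  all_moves : ∀ (ρ : List V) (v : V), ρ ++ [v] ∈ W → v ∈ G.V1 →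
    ∀ w, (v, w) ∈ G.E → ρ ++ [v, w] ∈ W

/-- The strategy tree `W` is winning: every infinite play in it visits `F` infinitely often.
A branch of a strategy tree can end only in a position of Player 1 without moves, and such a
branch is a win for Player 0. -/
def IsWinningTree (G : BuchiGame V) (W : Set (List V)) : Prop :=
  ∀ play : ℕ → V, (∀ n, (List.range (n + 1)).map play ∈ W) →
    ∃ᶠ n in Filter.atTop, play n ∈ G.F

/-- Player 0 has a winning strategy from `v`. -/
def WinsFrom (G : BuchiGame V) (v : V) : Prop :=
  ∃ W, G.IsStrategy v W ∧ G.IsWinningTree W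

/-- The game after deleting the moves in `R ∩ Em` and adding the moves in `R ∩ Ep`. -/
def modify (G : BuchiGame V) (Em Ep R : Set (V × V)) : BuchiGame V where
  V0 := G.V0
  V1 := G.V1
  isCompl := G.isCompl
  E := (G.E \ (R ∩ Em)) ∪ (R ∩ Ep)
  F := G.F

/-- `R ⊆ E⁻ ∪ E⁺` is a repair if Player 0 wins from `v` when the moves in `R` are deleted
or added. -/
def IsRepair (G : BuchiGame V) (Em Ep : Set (V × V)) (v : V) (R : Set (V × V)) : Prop :=
  R ⊆ Em ∪ Ep ∧ (G.modify Em Ep R).WinsFrom v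

end BuchiGame

/-! ## Generalized absorptive polynomials -/

/-- Monomials over `X` with exponents in `ℕ ∪ {∞}`; the product of monomials is the sum of the
exponent functions, and `m₁` absorbs `m₂` if `m₁ ≤ m₂` pointwise. -/
abbrev Monomial (X : Type*) := X → ℕ∞

/-- Absorptive polynomials: antichains of monomials. -/
@[ext] structure AbsPoly (X : Type*) where
  monomials : Set (Monomial X)
  antichain : IsAntichain (· ≤ ·) monomials

namespace AbsPoly

variable {X : Type*}

/-- Keep only those monomials of `S` that are not absorbed by another monomial of `S`. -/
def keep (S : Set (Monomial X)) : AbsPoly X where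
  monomials := {m | Minimal (· ∈ S) m}
  antichain := setOfPred_minimal_antichain _

instance : Zero (AbsPoly X) := ⟨⟨∅, by simp⟩⟩
instance : One (AbsPoly X) := ⟨⟨{0}, by simp⟩⟩
instance : Add (AbsPoly X) := ⟨fun p q => keep (p.monomials ∪ q.monomials)⟩
/-- Here `p.monomials + q.monomials` is the set of all products of a monomial of `p` and one
of `q`, as exponents are added. -/
instance : Mul (AbsPoly X) := ⟨fun p q => keep (p.monomials + q.monomials)⟩

/-- The indeterminate `x`. -/
def indet (x : X) : AbsPoly X := ⟨{Pi.single x 1}, by simp⟩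

/-- The set of all monomials absorbed by a monomial of `p`. -/
def up (p : AbsPoly X) : Set (Monomial X) := {m | ∃ m' ∈ p.monomials, m' ≤ m}

theorem up_injective : Function.Injective (up (X := X)) := by
  have key : ∀ p q : AbsPoly X, p.up = q.up → p.monomials ⊆ q.monomials := by
    intro p q h m hm
    have h1 : m ∈ q.up := h ▸ ⟨m, hm, le_rfl⟩
    obtain ⟨m', hm', hle⟩ := h1
    have h2 : m' ∈ p.up := h ▸ ⟨m', hm', le_rfl⟩
    obtain ⟨m'', hm'', hle'⟩ := h2
    have h3 : m'' = m := p.antichain.eq hm'' hm (hle'.trans hle)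
    have h4 : m = m' := le_antisymm (h3 ▸ hle') hle
    exact h4 ▸ hm'
  intro p q h
  exact AbsPoly.ext (Set.Subset.antisymm (key p q h) (key q p h.symm))

theorem ext_up {p q : AbsPoly X} (h : ∀ m, m ∈ p.up ↔ m ∈ q.up) : p = q :=
  up_injective (Set.ext h)

theorem up_upper (p : AbsPoly X) {m n : Monomial X} (hm : m ∈ p.up) (h : m ≤ n) : n ∈ p.up := by
  obtain ⟨m', h1, h2⟩ := hm
  exact ⟨m', h1, h2.trans h⟩

theorem mem_up_zero (m : Monomial X) : m ∈ (0 : AbsPoly X).up ↔ False :=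
  ⟨fun ⟨_, h, _⟩ => h, False.elim⟩

theorem mem_up_one (m : Monomial X) : m ∈ (1 : AbsPoly X).up ↔ True :=
  ⟨fun _ => trivial, fun _ => ⟨0, rfl, fun _ => bot_le⟩⟩

theorem mem_up_indet (x : X) (m : Monomial X) : m ∈ (AbsPoly.indet x).up ↔ 1 ≤ m x := by
  constructor
  · rintro ⟨m', h, hle⟩
    obtain rfl : m' = Pi.single x 1 := h
    simpa using hle x
  · intro h
    refine ⟨_, rfl, fun y => ?_⟩
    by_cases hy : y = x
    · subst hy; simpa using h
    · simp [hy]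

variable [Finite X]

theorem mem_up_keep (S : Set (Monomial X)) (m : Monomial X) :
    m ∈ (keep S).up ↔ ∃ m' ∈ S, m' ≤ m := by
  constructor
  · rintro ⟨m', h, hle⟩
    exact ⟨m', h.1, hle⟩
  · rintro ⟨m', h, hle⟩
    obtain ⟨n, hn, hmin⟩ := exists_minimal_le_of_wellFoundedLT (· ∈ S) m' h
    exact ⟨n, hmin, hn.trans hle⟩

theorem mem_up_add (p q : AbsPoly X) (m : Monomial X) :
    m ∈ (p + q).up ↔ m ∈ p.up ∨ m ∈ q.up := by
  refine (mem_up_keep _ m).trans ?_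
  constructor
  · rintro ⟨m', h | h, hle⟩
    · exact Or.inl ⟨m', h, hle⟩
    · exact Or.inr ⟨m', h, hle⟩
  · rintro (⟨m', h, hle⟩ | ⟨m', h, hle⟩)
    · exact ⟨m', Or.inl h, hle⟩
    · exact ⟨m', Or.inr h, hle⟩

theorem mem_up_mul (p q : AbsPoly X) (m : Monomial X) :
    m ∈ (p * q).up ↔ ∃ a ∈ p.up, ∃ b ∈ q.up, a + b ≤ m := by
  refine (mem_up_keep _ m).trans ?_
  constructor
  · rintro ⟨_, ⟨a, ha, b, hb, rfl⟩, hle⟩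
    exact ⟨a, ⟨a, ha, le_rfl⟩, b, ⟨b, hb, le_rfl⟩, hle⟩
  · rintro ⟨a, ⟨a', ha, hla⟩, b, ⟨b', hb, hlb⟩, hle⟩
    exact ⟨a' + b', Set.add_mem_add ha hb, (add_le_add hla hlb).trans hle⟩

instance : CommSemiring (AbsPoly X) where
  add_assoc a b c := ext_up fun m => by simp only [mem_up_add, or_assoc]
  zero_add a := ext_up fun m => by simp only [mem_up_add, mem_up_zero, false_or]
  add_zero a := ext_up fun m => by simp only [mem_up_add, mem_up_zero, or_false]
  add_comm a b := ext_up fun m => by simp only [mem_up_add, or_comm]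
  nsmul := nsmulRec
  left_distrib a b c := ext_up fun m => by
    simp only [mem_up_add, mem_up_mul]
    constructor
    · rintro ⟨x, hx, y, hy | hy, h⟩
      · exact Or.inl ⟨x, hx, y, hy, h⟩
      · exact Or.inr ⟨x, hx, y, hy, h⟩
    · rintro (⟨x, hx, y, hy, h⟩ | ⟨x, hx, y, hy, h⟩)
      · exact ⟨x, hx, y, Or.inl hy, h⟩
      · exact ⟨x, hx, y, Or.inr hy, h⟩
  right_distrib a b c := ext_up fun m => by
    simp only [mem_up_add, mem_up_mul]
    constructor
    · rintro ⟨x, hx | hx, y, hy, h⟩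
      · exact Or.inl ⟨x, hx, y, hy, h⟩
      · exact Or.inr ⟨x, hx, y, hy, h⟩
    · rintro (⟨x, hx, y, hy, h⟩ | ⟨x, hx, y, hy, h⟩)
      · exact ⟨x, Or.inl hx, y, hy, h⟩
      · exact ⟨x, Or.inr hx, y, hy, h⟩
  zero_mul a := ext_up fun m => by simp [mem_up_mul, mem_up_zero]
  mul_zero a := ext_up fun m => by simp [mem_up_mul, mem_up_zero]
  mul_assoc a b c := ext_up fun m => by
    simp only [mem_up_mul]
    constructor
    · rintro ⟨t, ⟨x, hx, y, hy, h⟩, z, hz, h'⟩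
      refine ⟨x, hx, y + z, ⟨y, hy, z, hz, le_rfl⟩, ?_⟩
      rw [← add_assoc]
      exact (add_le_add h le_rfl).trans h'
    · rintro ⟨x, hx, t, ⟨y, hy, z, hz, h⟩, h'⟩
      refine ⟨x + y, ⟨x, hx, y, hy, le_rfl⟩, z, hz, ?_⟩
      rw [add_assoc]
      exact (add_le_add le_rfl h).trans h'
  one_mul a := ext_up fun m => by
    simp only [mem_up_mul, mem_up_one]
    constructor
    · rintro ⟨x, -, y, hy, h⟩
      exact a.up_upper hy (le_trans (fun i => le_add_self) h)
    · intro h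
      exact ⟨0, trivial, m, h, by simp⟩
  mul_one a := ext_up fun m => by
    simp only [mem_up_mul, mem_up_one]
    constructor
    · rintro ⟨y, hy, x, -, h⟩
      exact a.up_upper hy (le_trans (fun i => le_self_add) h)
    · intro h
      exact ⟨m, h, 0, trivial, by simp⟩
  mul_comm a b := ext_up fun m => by
    simp only [mem_up_mul]
    constructor
    · rintro ⟨x, hx, y, hy, h⟩
      exact ⟨y, hy, x, hx, by rwa [add_comm]⟩
    · rintro ⟨x, hx, y, hy, h⟩
      exact ⟨y, hy, x, hx, by rwa [add_comm]⟩

end AbsPoly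

/-! ## Dual-indeterminate absorptive polynomials

The indeterminates are indexed by `X ⊕ X`: `Sum.inl x` stands for `x`, and `Sum.inr x` for the
dual indeterminate of `x`. -/

/-- The congruence generated by `x · x̄ = 0` for `x ∈ X`. -/
def dualCon (X : Type*) [Finite X] : RingCon (AbsPoly (X ⊕ X)) :=
  ringConGen fun p q =>
    ∃ x : X, p = AbsPoly.indet (Sum.inl x) * AbsPoly.indet (Sum.inr x) ∧ q = 0

/-- The quotient semiring of dual-indeterminate absorptive polynomials. -/
def DualAbsPoly (X : Type*) [Finite X] := (dualCon X).Quotient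

namespace DualAbsPoly

variable {X : Type*}

/-- A monomial is consistent if no indeterminate occurs in it together with its dual. -/
def Consistent (m : Monomial (X ⊕ X)) : Prop :=
  ∀ x : X, m (Sum.inl x) = 0 ∨ m (Sum.inr x) = 0

theorem Consistent.anti {m n : Monomial (X ⊕ X)} (hn : Consistent n) (h : m ≤ n) :
    Consistent m := fun x =>
  (hn x).imp (fun h0 => le_antisymm (h0 ▸ h _) bot_le) (fun h0 => le_antisymm (h0 ▸ h _) bot_le)

variable [Finite X]

instance : CommSemiring (DualAbsPoly X) :=
  inferInstanceAs (CommSemiring (dualCon X).Quotient)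

/-- The class of a polynomial in the quotient. -/
def mk (p : AbsPoly (X ⊕ X)) : DualAbsPoly X := (dualCon X).toQuotient p

/-- The indeterminate `x`. -/
def pos (x : X) : DualAbsPoly X := mk (AbsPoly.indet (Sum.inl x))

/-- The dual indeterminate of `x`. -/
def neg (x : X) : DualAbsPoly X := mk (AbsPoly.indet (Sum.inr x))

/-- The monomials of an element of the quotient: those of its (unique) representative without
contradictory monomials, which arises from any representative by dropping the contradictory
monomials. -/
def monomials (a : DualAbsPoly X) : Set (Monomial (X ⊕ X)) :=
  {m | Consistent m ∧ ∃ p, mk p = a ∧ m ∈ p.monomials}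

/-- Two polynomials are congruent iff they absorb the same consistent monomials. -/
theorem mk_eq_iff (p q : AbsPoly (X ⊕ X)) :
    mk p = mk q ↔ ∀ m, Consistent m → (m ∈ p.up ↔ m ∈ q.up) := by
  have h0 : mk p = mk q ↔ dualCon X p q := (dualCon X).eq
  rw [h0]
  constructor
  · intro h
    let c : RingCon (AbsPoly (X ⊕ X)) :=
      { r := fun p q => ∀ m, Consistent m → (m ∈ p.up ↔ m ∈ q.up)
        iseqv := ⟨fun _ _ _ => Iff.rfl, fun h m hm => (h m hm).symm,
          fun h h' m hm => (h m hm).trans (h' m hm)⟩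
        add' := by
          intro a b c d h h' m hm
          rw [AbsPoly.mem_up_add, AbsPoly.mem_up_add, h m hm, h' m hm]
        mul' := by
          intro a b c d h h' m hm
          rw [AbsPoly.mem_up_mul, AbsPoly.mem_up_mul]
          constructor
          · rintro ⟨x, hx, y, hy, hle⟩
            exact ⟨x, (h x (hm.anti (le_trans (fun i => le_self_add) hle))).1 hx,
              y, (h' y (hm.anti (le_trans (fun i => le_add_self) hle))).1 hy, hle⟩
          · rintro ⟨x, hx, y, hy, hle⟩
            exact ⟨x, (h x (hm.anti (le_trans (fun i => le_self_add) hle))).2 hx,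
              y, (h' y (hm.anti (le_trans (fun i => le_add_self) hle))).2 hy, hle⟩ }
    have hc : dualCon X ≤ c := by
      refine RingCon.ringConGen_le.2 ?_
      rintro _ _ ⟨x, rfl, rfl⟩ m hm
      simp only [AbsPoly.mem_up_zero, iff_false, AbsPoly.mem_up_mul, AbsPoly.mem_up_indet]
      rintro ⟨a, ha, b, hb, hle⟩
      have h1 : 1 ≤ m (Sum.inl x) := ha.trans (le_self_add.trans (hle (Sum.inl x)))
      have h2 : 1 ≤ m (Sum.inr x) := hb.trans (le_add_self.trans (hle (Sum.inr x)))
      rcases hm x with h | h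
      · simp [h] at h1
      · simp [h] at h2
    exact hc h
  · intro h
    have := Fintype.ofFinite X
    have hB : ∀ s : Finset X, dualCon X
        (∑ x ∈ s, AbsPoly.indet (Sum.inl x) * AbsPoly.indet (Sum.inr x)) 0 := by
      intro s
      induction s using Finset.induction_on with
      | empty => simpa using (dualCon X).refl 0
      | insert a s ha ih =>
        rw [Finset.sum_insert ha]
        have h1 : dualCon X (AbsPoly.indet (Sum.inl a) * AbsPoly.indet (Sum.inr a)) 0 :=
          RingConGen.Rel.of _ _ ⟨a, rfl, rfl⟩
        simpa using (dualCon X).add h1 ih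
    have hup : ∀ (s : Finset X) (m : Monomial (X ⊕ X)),
        m ∈ (∑ x ∈ s, AbsPoly.indet (Sum.inl x) * AbsPoly.indet (Sum.inr x) : AbsPoly (X ⊕ X)).up ↔
          ∃ x ∈ s, m ∈ (AbsPoly.indet (Sum.inl x) * AbsPoly.indet (Sum.inr x) : AbsPoly (X ⊕ X)).up := by
      intro s m
      induction s using Finset.induction_on with
      | empty => simp [AbsPoly.mem_up_zero]
      | insert a s ha ih => rw [Finset.sum_insert ha, AbsPoly.mem_up_add, ih]; simp
    have heq : p + ∑ x, AbsPoly.indet (Sum.inl x) * AbsPoly.indet (Sum.inr x) =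
        q + ∑ x, AbsPoly.indet (Sum.inl x) * AbsPoly.indet (Sum.inr x) := by
      refine AbsPoly.up_injective (Set.ext fun m => ?_)
      rw [AbsPoly.mem_up_add, AbsPoly.mem_up_add]
      by_cases hm : Consistent m
      · rw [h m hm]
      · have : m ∈ (∑ x, AbsPoly.indet (Sum.inl x) * AbsPoly.indet (Sum.inr x) :
            AbsPoly (X ⊕ X)).up := by
          rw [hup]
          unfold Consistent at hm
          push Not at hm
          obtain ⟨x, h1, h2⟩ := hm
          refine ⟨x, Finset.mem_univ _, ?_⟩
          rw [AbsPoly.mem_up_mul]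
          refine ⟨Pi.single (Sum.inl x) 1, ?_, Pi.single (Sum.inr x) 1, ?_, ?_⟩
          · simp [AbsPoly.mem_up_indet]
          · simp [AbsPoly.mem_up_indet]
          · intro y
            by_cases hy : y = Sum.inl x
            · subst hy; simpa using Order.one_le_iff_ne_zero.2 h1
            · by_cases hy' : y = Sum.inr x
              · subst hy'; simpa using Order.one_le_iff_ne_zero.2 h2
              · simp [hy, hy']
        simp [this]
    have hp : ∀ r : AbsPoly (X ⊕ X), dualCon X
        (r + ∑ x, AbsPoly.indet (Sum.inl x) * AbsPoly.indet (Sum.inr x)) r := by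
      intro r
      simpa using (dualCon X).add ((dualCon X).refl r) (hB Finset.univ)
    exact (dualCon X).trans ((dualCon X).symm (hp p)) (heq ▸ hp q)

theorem mk_surjective : Function.Surjective (mk (X := X)) := fun a => Quotient.exists_rep a

theorem mk_add (p q : AbsPoly (X ⊕ X)) : mk (p + q) = mk p + mk q := rfl

theorem mk_mul (p q : AbsPoly (X ⊕ X)) : mk (p * q) = mk p * mk q := rfl

theorem mem_monomials_mk (p : AbsPoly (X ⊕ X)) (m : Monomial (X ⊕ X)) :
    m ∈ (mk p).monomials ↔ Consistent m ∧ m ∈ p.monomials := by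
  constructor
  · rintro ⟨hm, q, hq, h⟩
    have hqp := (mk_eq_iff q p).1 hq
    obtain ⟨m', h', hle'⟩ := (hqp m hm).1 ⟨m, h, le_rfl⟩
    obtain ⟨m'', h'', hle''⟩ := (hqp m' (hm.anti hle')).2 ⟨m', h', le_rfl⟩
    obtain rfl : m'' = m := q.antichain.eq h'' h (hle''.trans hle')
    obtain rfl : m' = m'' := le_antisymm hle' hle''
    exact ⟨hm, h'⟩
  · rintro ⟨hm, h⟩
    exact ⟨hm, p, rfl, h⟩

/-- The consistent monomials absorbed by an element of the quotient. -/
def up (a : DualAbsPoly X) : Set (Monomial (X ⊕ X)) :=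
  {m | Consistent m ∧ ∃ p, mk p = a ∧ m ∈ p.up}

theorem mem_up_mk (p : AbsPoly (X ⊕ X)) (m : Monomial (X ⊕ X)) :
    m ∈ (mk p).up ↔ Consistent m ∧ m ∈ p.up := by
  constructor
  · rintro ⟨hm, q, hq, h⟩
    exact ⟨hm, ((mk_eq_iff q p).1 hq m hm).1 h⟩
  · rintro ⟨hm, h⟩
    exact ⟨hm, p, rfl, h⟩

theorem up_injective : Function.Injective (up (X := X)) := by
  intro a b h
  obtain ⟨p, rfl⟩ := mk_surjective a
  obtain ⟨q, rfl⟩ := mk_surjective b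
  refine (mk_eq_iff p q).2 fun m hm => ?_
  have := Set.ext_iff.1 h m
  simpa [mem_up_mk, hm] using this

theorem up_add (a b : DualAbsPoly X) : (a + b).up = a.up ∪ b.up := by
  obtain ⟨p, rfl⟩ := mk_surjective a
  obtain ⟨q, rfl⟩ := mk_surjective b
  ext m
  rw [← mk_add, Set.mem_union, mem_up_mk, mem_up_mk, mem_up_mk, AbsPoly.mem_up_add, and_or_left]

theorem add_eq_right_iff (a b : DualAbsPoly X) : a + b = b ↔ a.up ⊆ b.up := by
  rw [← up_injective.eq_iff, up_add, Set.union_eq_right]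

/-- The natural order of the semiring. -/
instance : PartialOrder (DualAbsPoly X) where
  le a b := a + b = b
  le_refl a := (add_eq_right_iff a a).2 subset_rfl
  le_trans a b c h h' := (add_eq_right_iff a c).2
    (((add_eq_right_iff a b).1 h).trans ((add_eq_right_iff b c).1 h'))
  le_antisymm a b h h' := up_injective
    (((add_eq_right_iff a b).1 h).antisymm ((add_eq_right_iff b a).1 h'))

theorem le_iff_up (a b : DualAbsPoly X) : a ≤ b ↔ a.up ⊆ b.up := add_eq_right_iff a b

instance : SupSet (DualAbsPoly X) := ⟨fun S => mk (AbsPoly.keep (⋃ a ∈ S, a.up))⟩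

theorem up_sSup (S : Set (DualAbsPoly X)) : (sSup S).up = ⋃ a ∈ S, a.up := by
  ext m
  refine (mem_up_mk _ m).trans ?_
  rw [AbsPoly.mem_up_keep]
  constructor
  · rintro ⟨hm, m', hm', hle⟩
    simp only [Set.mem_iUnion] at hm' ⊢
    obtain ⟨a, ha, _, p, hp, h⟩ := hm'
    exact ⟨a, ha, hm, p, hp, p.up_upper h hle⟩
  · intro h
    refine ⟨?_, m, h, le_rfl⟩
    simp only [Set.mem_iUnion] at h
    obtain ⟨a, _, hm, _⟩ := h
    exact hm

/-- The natural order is a complete lattice. -/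
instance : CompleteLattice (DualAbsPoly X) :=
  completeLatticeOfSup (DualAbsPoly X) fun S => by
    constructor
    · intro a ha
      rw [le_iff_up, up_sSup]
      exact Set.subset_biUnion_of_mem (u := fun a : DualAbsPoly X => a.up) ha
    · intro b hb
      rw [le_iff_up, up_sSup]
      exact Set.iUnion₂_subset fun a ha => (le_iff_up a b).1 (hb ha)

end DualAbsPoly

/-! ## Semiring semantics of fixed-point logic over games -/

/-- The instantiated literals over the signature `{E, F, V₀, V₁}`, except for (in)equalities. -/
inductive GameLit (V : Type*) where
  | E (v w : V)
  | notE (v w : V)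
  | F (v : V)
  | notF (v : V)
  | V0 (v : V)
  | notV0 (v : V)
  | V1 (v : V)
  | notV1 (v : V)

/-- Literals with first-order variables (named by natural numbers) are instantiated by means
of an assignment. -/
def GameLit.map {V W : Type*} (s : V → W) : GameLit V → GameLit W
  | .E v w => .E (s v) (s w)
  | .notE v w => .notE (s v) (s w)
  | .F v => .F (s v)
  | .notF v => .notF (s v)
  | .V0 v => .V0 (s v)
  | .notV0 v => .notV0 (s v)
  | .V1 v => .V1 (s v)
  | .notV1 v => .notV1 (s v)

/-- Formulae of fixed-point logic in negation normal form over the signature `{E, F, V₀, V₁}`,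
with unary fixed-point relations. First-order and relation variables are named by natural
numbers. `lfp R x φ y` is `[lfp R x. φ](y)`, and likewise for `gfp`. -/
inductive Formula where
  | lit (l : GameLit ℕ)
  | eq (x y : ℕ)
  | ne (x y : ℕ)
  | rel (R x : ℕ)
  | and (φ ψ : Formula)
  | or (φ ψ : Formula)
  | ex (x : ℕ) (φ : Formula)
  | all (x : ℕ) (φ : Formula)
  | lfp (R x : ℕ) (φ : Formula) (y : ℕ)
  | gfp (R x : ℕ) (φ : Formula) (y : ℕ)

/-- The value of a formula under the interpretation `π`, where `g` holds the values of the
relation variables and `s` those of the first-order variables. The least fixed point of the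
(monotone) operator induced by a formula is its least pre-fixed point, and the greatest one is
its greatest post-fixed point. -/
def Formula.eval {V K : Type*} [Fintype V] [CommSemiring K] [CompleteLattice K]
    (π : GameLit V → K) : Formula → (ℕ → V → K) → (ℕ → V) → K
  | .lit l, _, s => π (l.map s)
  | .eq x y, _, s => if s x = s y then 1 else 0
  | .ne x y, _, s => if s x = s y then 0 else 1
  | .rel R x, g, s => g R (s x)
  | .and φ ψ, g, s => φ.eval π g s * ψ.eval π g s
  | .or φ ψ, g, s => φ.eval π g s + ψ.eval π g s
  | .ex x φ, g, s => ∑ a : V, φ.eval π g (Function.update s x a)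
  | .all x φ, g, s => ∏ a : V, φ.eval π g (Function.update s x a)
  | .lfp R x φ y, g, s =>
      sInf {f : V → K |
        (fun a => φ.eval π (Function.update g R f) (Function.update s x a)) ≤ f} (s y)
  | .gfp R x φ y, g, s =>
      sSup {f : V → K |
        f ≤ fun a => φ.eval π (Function.update g R f) (Function.update s x a)} (s y)

/-- For the relation variable `T`, the formula
`(V₀ z ∧ ∃ u (E z u ∧ T u)) ∨ (V₁ z ∧ ∀ u (¬ E z u ∨ (E z u ∧ T u)))`, with `z = 2`, `u = 3`. -/
def stepFormula (T : ℕ) : Formula :=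
  .or (.and (.lit (.V0 2)) (.ex 3 (.and (.lit (.E 2 3)) (.rel T 3))))
    (.and (.lit (.V1 2)) (.all 3 (.or (.lit (.notE 2 3)) (.and (.lit (.E 2 3)) (.rel T 3)))))

/-- The formula `[gfp Y y. [lfp Z z. (F z ∧ step Y) ∨ (¬ F z ∧ step Z)](y)](x)` that defines the
winning region of Player 0, with `x = 0`, `y = 1`, `z = 2`, `u = 3` and `Y = 0`, `Z = 1`. -/
def winFormula : Formula :=
  .gfp 0 1
    (.lfp 1 2
      (.or (.and (.lit (.F 2)) (stepFormula 0)) (.and (.lit (.notF 2)) (stepFormula 1))) 1) 0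

/-- The value of the sentence `win₀(v)` under the interpretation `π`. -/
def winValue {V K : Type*} [Fintype V] [CommSemiring K] [CompleteLattice K]
    (π : GameLit V → K) (v : V) : K :=
  winFormula.eval π (fun _ _ => 0) (fun _ => v)

/-! ## The repair interpretation -/

/-- The repair interpretation, with one indeterminate for each edge in `E⁻ ∪ E⁺`. -/
def repairInterp {V : Type*} [Finite V] (G : BuchiGame V) (Em Ep : Set (V × V)) :
    GameLit V → DualAbsPoly ↥(Em ∪ Ep)
  | .E v w => if h : (v, w) ∈ Em ∪ Ep then DualAbsPoly.pos ⟨(v, w), h⟩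
      else if (v, w) ∈ G.E then 1 else 0
  | .notE v w => if h : (v, w) ∈ Em ∪ Ep then DualAbsPoly.neg ⟨(v, w), h⟩
      else if (v, w) ∈ G.E then 0 else 1
  | .F v => if v ∈ G.F then 1 else 0
  | .notF v => if v ∈ G.F then 0 else 1
  | .V0 v => if v ∈ G.V0 then 1 else 0
  | .notV0 v => if v ∈ G.V0 then 0 else 1
  | .V1 v => if v ∈ G.V1 then 1 else 0
  | .notV1 v => if v ∈ G.V1 then 0 else 1

/-- The (dual-)indeterminates that occur in a monomial. -/
def Monomial.vars {X : Type*} (m : Monomial X) : Set X := {x | 0 < m x}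

/-- The set `X^± = {X_e | e ∈ E⁺} ∪ {X̄_e | e ∈ E⁻}`. -/
def repairVars {V : Type*} (Em Ep : Set (V × V)) : Set (↥(Em ∪ Ep) ⊕ ↥(Em ∪ Ep)) :=
  Sum.inl '' {e | e.1 ∈ Ep} ∪ Sum.inr '' {e | e.1 ∈ Em}

/-- The set `E(Y)` of the edges mentioned by the (dual-)indeterminates in `Y`. -/
def edgesOf {V : Type*} {Em Ep : Set (V × V)} (Y : Set (↥(Em ∪ Ep) ⊕ ↥(Em ∪ Ep))) :
    Set (V × V) :=
  {e | ∃ h : e ∈ Em ∪ Ep, Sum.inl ⟨e, h⟩ ∈ Y ∨ Sum.inr ⟨e, h⟩ ∈ Y}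

end

/-! The exponent `∞` is idempotent, so for a set `S` of dual-indeterminates containing no
complementary pair, "the monomial with exponent `∞` exactly on `S` is absorbed by `a`" turns sums
and suprema into disjunctions, products and infima into conjunctions. It therefore commutes with
the evaluation of every fixed-point formula (`mem_up_eval`): the monomial is absorbed by
`π⟦φ⟧` iff `φ` holds in the two-valued (possibly incomplete) interpretation in which a literal is
true iff its value under `π` absorbs the monomial.

For the repair interpretation, the two-valued interpretation belonging to `S` lies below the
classical interpretation of the modified game whose repair set is read off from `S`
(`subset_trueVars_edgesOf`, `classicalInterp_of_subset_trueVars`), and for the set `S` of all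
literals over the repairable edges that are true in a modified game it lies above the classical
interpretation of that game (`infty_trueVars_mem_up_of_classicalInterp`). As fixed-point formulae
are monotone in the literals, both claims reduce to the classical fact that `winFormula` defines the
winning region of Player 0 in a Büchi game (`BuchiGame.winsFrom_iff_holds`). That fact is proved by
extracting from the nested fixed point a rank that decreases along the moves of a positional
strategy until `F` is reached, and conversely by observing that the positions visited by a winning
strategy tree form a post-fixed point: otherwise an infinite play in the tree could avoid `F` from
some point on. -/

/-! ### Two-valued semantics -/

/-- Two-valued semantics of formulae, for an arbitrary assignment `π` of truth values to the
literals; `π` need not make exactly one of two complementary literals true. The least fixed point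
is the intersection of the pre-fixed points, the greatest one the union of the post-fixed points. -/
def Formula.Holds {V : Type*} (π : GameLit V → Prop) :
    Formula → (ℕ → V → Prop) → (ℕ → V) → Prop
  | .lit l, _, s => π (l.map s)
  | .eq x y, _, s => s x = s y
  | .ne x y, _, s => s x ≠ s y
  | .rel R x, g, s => g R (s x)
  | .and φ ψ, g, s => φ.Holds π g s ∧ ψ.Holds π g s
  | .or φ ψ, g, s => φ.Holds π g s ∨ ψ.Holds π g s
  | .ex x φ, g, s => ∃ a : V, φ.Holds π g (Function.update s x a)
  | .all x φ, g, s => ∀ a : V, φ.Holds π g (Function.update s x a)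
  | .lfp R x φ y, g, s => ∀ P : V → Prop,
      (∀ a, φ.Holds π (Function.update g R P) (Function.update s x a) → P a) → P (s y)
  | .gfp R x φ y, g, s => ∃ P : V → Prop,
      (∀ a, P a → φ.Holds π (Function.update g R P) (Function.update s x a)) ∧ P (s y)

theorem Formula.Holds.mono {V : Type*} {π π' : GameLit V → Prop} (h : ∀ l, π l → π' l)
    {φ : Formula} {g : ℕ → V → Prop} {s : ℕ → V} : φ.Holds π g s → φ.Holds π' g s := by
  induction φ generalizing g s with
  | lit l => exact h _
  | eq | ne | rel => exact id
  | and φ ψ ih₁ ih₂ => exact And.imp ih₁ ih₂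
  | or φ ψ ih₁ ih₂ => exact Or.imp ih₁ ih₂
  | ex x φ ih => exact fun ⟨a, ha⟩ => ⟨a, ih ha⟩
  | all x φ ih => exact fun H a => ih (H a)
  | lfp R x φ y ih => exact fun H P hP => H P fun a ha => hP a (ih ha)
  | gfp R x φ y ih => exact fun ⟨P, hP, hy⟩ => ⟨P, fun a ha => ih (hP a ha), hy⟩

/-! ### Absorption of monomials in the quotient -/

namespace DualAbsPoly

variable {X : Type*} [Finite X]

theorem mem_up_of_le {a : DualAbsPoly X} {m n : Monomial (X ⊕ X)} (hm : m ∈ a.up) (h : m ≤ n)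
    (hn : Consistent n) : n ∈ a.up := by
  obtain ⟨_, p, hp, hmp⟩ := hm
  exact ⟨hn, p, hp, p.up_upper hmp h⟩

theorem mem_up_of_mem_monomials {a : DualAbsPoly X} {m : Monomial (X ⊕ X)}
    (h : m ∈ a.monomials) : m ∈ a.up := by
  obtain ⟨hm, p, hp, hmp⟩ := h
  exact ⟨hm, p, hp, m, hmp, le_rfl⟩

theorem exists_mem_monomials_le {a : DualAbsPoly X} {m : Monomial (X ⊕ X)} (h : m ∈ a.up) :
    ∃ m' ∈ a.monomials, m' ≤ m := by
  obtain ⟨hm, p, hp, m', hm', hle⟩ := h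
  exact ⟨m', ⟨hm.anti hle, p, hp, hm'⟩, hle⟩

theorem mem_up_zero (m : Monomial (X ⊕ X)) : m ∈ (0 : DualAbsPoly X).up ↔ False :=
  (mem_up_mk 0 m).trans (by simp [AbsPoly.mem_up_zero])

theorem mem_up_one (m : Monomial (X ⊕ X)) : m ∈ (1 : DualAbsPoly X).up ↔ Consistent m :=
  (mem_up_mk 1 m).trans (by simp [AbsPoly.mem_up_one])

theorem mem_up_pos (x : X) (m : Monomial (X ⊕ X)) :
    m ∈ (pos x).up ↔ Consistent m ∧ 1 ≤ m (Sum.inl x) := by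
  rw [pos, mem_up_mk, AbsPoly.mem_up_indet]

theorem mem_up_neg (x : X) (m : Monomial (X ⊕ X)) :
    m ∈ (neg x).up ↔ Consistent m ∧ 1 ≤ m (Sum.inr x) := by
  rw [neg, mem_up_mk, AbsPoly.mem_up_indet]

theorem mem_up_add (a b : DualAbsPoly X) (m : Monomial (X ⊕ X)) :
    m ∈ (a + b).up ↔ m ∈ a.up ∨ m ∈ b.up := by
  rw [up_add, Set.mem_union]

theorem mem_up_sum {ι : Type*} (s : Finset ι) (f : ι → DualAbsPoly X) (m : Monomial (X ⊕ X)) :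
    m ∈ (∑ i ∈ s, f i).up ↔ ∃ i ∈ s, m ∈ (f i).up := by
  induction s using Finset.induction_on with
  | empty => simp [mem_up_zero]
  | insert i s hi ih => rw [Finset.sum_insert hi, mem_up_add, ih]; simp

theorem mem_up_mul_of_idem (a b : DualAbsPoly X) {m : Monomial (X ⊕ X)} (hm : m + m = m) :
    m ∈ (a * b).up ↔ m ∈ a.up ∧ m ∈ b.up := by
  obtain ⟨p, rfl⟩ := mk_surjective a
  obtain ⟨q, rfl⟩ := mk_surjective b
  rw [← mk_mul, mem_up_mk, mem_up_mk, mem_up_mk, AbsPoly.mem_up_mul]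
  constructor
  · rintro ⟨hc, x, hx, y, hy, hle⟩
    exact ⟨⟨hc, p.up_upper hx (le_trans (fun _ => le_self_add) hle)⟩,
      hc, q.up_upper hy (le_trans (fun _ => le_add_self) hle)⟩
  · rintro ⟨⟨hc, hp⟩, -, hq⟩
    exact ⟨hc, m, hp, m, hq, hm.le⟩

theorem mem_up_prod_of_idem {ι : Type*} (s : Finset ι) (f : ι → DualAbsPoly X)
    {m : Monomial (X ⊕ X)} (hc : Consistent m) (hm : m + m = m) :
    m ∈ (∏ i ∈ s, f i).up ↔ ∀ i ∈ s, m ∈ (f i).up := by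
  induction s using Finset.induction_on with
  | empty => simpa [mem_up_one] using hc
  | insert i s hi ih => rw [Finset.prod_insert hi, mem_up_mul_of_idem _ _ hm, ih]; simp

/-- Every set of consistent monomials that is closed under absorption is realized by an element
of the quotient. -/
theorem exists_up_eq (S : Set (Monomial (X ⊕ X))) (hS : ∀ m ∈ S, Consistent m)
    (hup : ∀ m ∈ S, ∀ n, m ≤ n → Consistent n → n ∈ S) : ∃ a : DualAbsPoly X, a.up = S := by
  refine ⟨mk (AbsPoly.keep S), Set.ext fun m => ?_⟩
  rw [mem_up_mk, AbsPoly.mem_up_keep]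
  exact ⟨fun ⟨hm, n, hn, hle⟩ => hup n hn m hle hm, fun h => ⟨hS m h, m, h, le_rfl⟩⟩

theorem mem_up_sSup (S : Set (DualAbsPoly X)) (m : Monomial (X ⊕ X)) :
    m ∈ (sSup S).up ↔ ∃ a ∈ S, m ∈ a.up := by
  simp [up_sSup]

theorem mem_up_sInf (S : Set (DualAbsPoly X)) {m : Monomial (X ⊕ X)} (hm : Consistent m) :
    m ∈ (sInf S).up ↔ ∀ a ∈ S, m ∈ a.up := by
  constructor
  · exact fun h a ha => (le_iff_up _ _).1 (sInf_le ha) h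
  · intro h
    obtain ⟨b, hb⟩ := exists_up_eq {n | m ≤ n ∧ Consistent n} (fun n hn => hn.2)
      (fun n hn k hle hk => ⟨hn.1.trans hle, hk⟩)
    have hle : b ≤ sInf S := le_sInf fun a ha => (le_iff_up _ _).2 <| by
      rw [hb]
      exact fun n hn => mem_up_of_le (h a ha) hn.1 hn.2
    exact (le_iff_up _ _).1 hle (hb ▸ ⟨le_rfl, hm⟩)

/-! ### Transfer to the two-valued semantics -/

/-- Absorption of an idempotent consistent monomial commutes with the evaluation of formulae. -/
theorem mem_up_eval {V : Type*} [Fintype V] {m : Monomial (X ⊕ X)} (hc : Consistent m)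
    (hm : m + m = m) (π : GameLit V → DualAbsPoly X) (φ : Formula)
    (g : ℕ → V → DualAbsPoly X) (s : ℕ → V) :
    m ∈ (φ.eval π g s).up ↔
      φ.Holds (fun l => m ∈ (π l).up) (fun R a => m ∈ (g R a).up) s := by
  -- Updating the values of a relation variable commutes with passing to truth values.
  have hupd : ∀ (g : ℕ → V → DualAbsPoly X) (R : ℕ) (f : V → DualAbsPoly X),
      (fun R' a => m ∈ (Function.update g R f R' a).up) =
        Function.update (fun R a => m ∈ (g R a).up) R (fun a => m ∈ (f a).up) := by
    intro g R f
    funext R'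
    by_cases h : R' = R
    · subst h; simp
    · simp [h]
  induction φ generalizing g s with
  | lit l => exact Iff.rfl
  | eq x y =>
    simp only [Formula.eval, Formula.Holds]
    split_ifs with h <;> simp [h, mem_up_one, mem_up_zero, hc]
  | ne x y =>
    simp only [Formula.eval, Formula.Holds]
    split_ifs with h <;> simp [h, mem_up_one, mem_up_zero, hc]
  | rel R x => exact Iff.rfl
  | and φ ψ ih₁ ih₂ =>
    simp only [Formula.eval, Formula.Holds, mem_up_mul_of_idem _ _ hm, ih₁, ih₂]
  | or φ ψ ih₁ ih₂ => simp only [Formula.eval, Formula.Holds, mem_up_add, ih₁, ih₂]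
  | ex x φ ih => simp [Formula.eval, Formula.Holds, mem_up_sum, ih]
  | all x φ ih => simp [Formula.eval, Formula.Holds, mem_up_prod_of_idem _ _ hc hm, ih]
  | lfp R x φ y ih =>
    simp only [Formula.eval, Formula.Holds, sInf_apply, iInf, mem_up_sInf _ hc]
    constructor
    · intro H P hP
      -- The largest function whose truth values at `m` are given by `P`.
      have hf : ∀ a, ∃ b : DualAbsPoly X, b.up = {n | Consistent n ∧ (P a ∨ ¬ n ≤ m)} :=
        fun a => exists_up_eq _ (fun n hn => hn.1) fun n hn k hle hk =>
          ⟨hk, hn.2.imp_right fun h h' => h (hle.trans h')⟩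
      choose f hf using hf
      have hfm : (fun a => m ∈ (f a).up) = P := by
        funext a; simp [hf, hc]
      have hpre : (fun a => φ.eval π (Function.update g R f) (Function.update s x a)) ≤ f := by
        intro a
        rw [le_iff_up, hf]
        refine fun n hn => ⟨hn.1, or_iff_not_imp_right.2 fun hle => hP a ?_⟩
        have := (ih _ _).1 (mem_up_of_le hn (not_not.1 hle) hc)
        rwa [hupd, hfm] at this
      have := H (f (s y)) ⟨⟨f, hpre⟩, rfl⟩
      exact hfm ▸ this
    · rintro H _ ⟨⟨f, hpre⟩, rfl⟩
      refine H (fun a => m ∈ (f a).up) fun a ha => (le_iff_up _ _).1 (hpre a) ?_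
      refine (ih _ _).2 ?_
      rw [hupd]
      exact ha
  | gfp R x φ y ih =>
    simp only [Formula.eval, Formula.Holds, sSup_apply, iSup, mem_up_sSup]
    constructor
    · rintro ⟨_, ⟨⟨f, hpost⟩, rfl⟩, hy⟩
      refine ⟨fun a => m ∈ (f a).up, fun a ha => ?_, hy⟩
      have := (ih _ _).1 ((le_iff_up _ _).1 (hpost a) ha)
      rwa [hupd] at this
    · rintro ⟨P, hP, hy⟩
      -- The least function whose truth values at `m` are given by `P`.
      have hf : ∀ a, ∃ b : DualAbsPoly X, b.up = {n | Consistent n ∧ P a ∧ m ≤ n} :=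
        fun a => exists_up_eq _ (fun n hn => hn.1) fun n hn k hle hk =>
          ⟨hk, hn.2.1, hn.2.2.trans hle⟩
      choose f hf using hf
      have hfm : (fun a => m ∈ (f a).up) = P := by
        funext a; simp [hf, hc]
      have hpost : f ≤ fun a => φ.eval π (Function.update g R f) (Function.update s x a) := by
        intro a
        rw [le_iff_up, hf]
        refine fun n hn => mem_up_of_le ((ih _ _).2 ?_) hn.2.2 hn.1
        rw [hupd, hfm]
        exact hP a hn.2.1
      exact ⟨f (s y), ⟨⟨f, hpost⟩, rfl⟩, (congrFun hfm (s y)).mpr hy⟩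

end DualAbsPoly

/-- The monomial with exponent `∞` on `S` and exponent `0` elsewhere. -/
noncomputable def Monomial.infty {X : Type*} (S : Set X) : Monomial X :=
  fun x => if x ∈ S then ⊤ else 0

namespace Monomial

variable {X : Type*}

theorem infty_add_self (S : Set X) : infty S + infty S = infty S := by
  funext x
  by_cases h : x ∈ S <;> simp [infty, h]

theorem one_le_infty_iff {S : Set X} {x : X} : 1 ≤ infty S x ↔ x ∈ S := by
  by_cases h : x ∈ S <;> simp [infty, h]

theorem le_infty_vars (m : Monomial X) : m ≤ infty m.vars := by
  intro x
  by_cases h : m x = 0 <;> simp [infty, vars, h, pos_iff_ne_zero]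

theorem vars_subset_of_le_infty {m : Monomial X} {S : Set X} (h : m ≤ infty S) : m.vars ⊆ S := by
  intro x hx
  by_contra hS
  have := (h x).trans_eq (if_neg hS)
  exact (not_le_of_gt hx) this

theorem consistent_infty {S : Set (X ⊕ X)} (h : ∀ x, Sum.inl x ∈ S → Sum.inr x ∉ S) :
    DualAbsPoly.Consistent (infty S) := by
  intro x
  by_cases hx : Sum.inl x ∈ S
  · exact Or.inr (if_neg (h x hx))
  · exact Or.inl (if_neg hx)

end Monomial

/-! ### The winning region of a Büchi game -/

namespace BuchiGame

variable {V : Type*}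

/-- The truth values of the literals in the game `G`. -/
def classicalInterp (G : BuchiGame V) : GameLit V → Prop
  | .E v w => (v, w) ∈ G.E
  | .notE v w => (v, w) ∉ G.E
  | .F v => v ∈ G.F
  | .notF v => v ∉ G.F
  | .V0 v => v ∈ G.V0
  | .notV0 v => v ∉ G.V0
  | .V1 v => v ∈ G.V1
  | .notV1 v => v ∉ G.V1

/-- Player 0 can ensure that the next position exists (if it is her turn) and lies in `T`; a dead
end of Player 1 satisfies this for every `T`. -/
def Step (G : BuchiGame V) (T : V → Prop) (z : V) : Prop :=
  (z ∈ G.V0 ∧ ∃ u, (z, u) ∈ G.E ∧ T u) ∨ (z ∈ G.V1 ∧ ∀ u, (z, u) ∈ G.E → T u)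

theorem Step.mono {G : BuchiGame V} {T T' : V → Prop} (h : ∀ u, T u → T' u) {z : V} :
    G.Step T z → G.Step T' z :=
  Or.imp (And.imp_right fun ⟨u, hu, hT⟩ => ⟨u, hu, h u hT⟩)
    (And.imp_right fun H u hu => h u (H u hu))

/-- The operator of the inner fixed point of `winFormula`. -/
def inner (G : BuchiGame V) (Y Z : V → Prop) (z : V) : Prop :=
  (z ∈ G.F ∧ G.Step Y z) ∨ (z ∉ G.F ∧ G.Step Z z)

/-- The two-valued reading of `winFormula`. -/
def InWin (G : BuchiGame V) (v : V) : Prop :=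
  ∃ Y : V → Prop, (∀ y, Y y → ∀ Z : V → Prop, (∀ z, G.inner Y Z z → Z z) → Z y) ∧ Y v

theorem holds_winFormula_iff (G : BuchiGame V) (g : ℕ → V → Prop) (v : V) :
    winFormula.Holds G.classicalInterp g (fun _ => v) ↔ G.InWin v := by
  simp [winFormula, stepFormula, Formula.Holds, GameLit.map, classicalInterp, InWin, inner, Step,
    Function.update_of_ne, imp_iff_not_or, or_and_left, em']

/-- A set `Z` of positions with a rank that decreases along the moves of Player 0's strategy and
along all moves of Player 1, except at positions in `F`. -/
structure IsRanked (G : BuchiGame V) (Z : V → Prop) (r : V → ℕ) : Prop where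
  exists_move : ∀ z, Z z → z ∈ G.V0 → ∃ u, (z, u) ∈ G.E ∧ Z u ∧ (z ∉ G.F → r u < r z)
  all_moves : ∀ z, Z z → z ∈ G.V1 → ∀ u, (z, u) ∈ G.E → Z u ∧ (z ∉ G.F → r u < r z)

theorem mem_V0_or_mem_V1 (G : BuchiGame V) (z : V) : z ∈ G.V0 ∨ z ∈ G.V1 := by
  have h : z ∈ G.V0 ⊔ G.V1 := by
    rw [G.isCompl.sup_eq_top]
    trivial
  exact h

theorem not_mem_V1 (G : BuchiGame V) {z : V} (h : z ∈ G.V0) : z ∉ G.V1 :=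
  fun h' => Set.disjoint_left.1 G.isCompl.disjoint h h'

/-- The stages of the inner least fixed point yield a rank. -/
theorem InWin.exists_isRanked [Finite V] {G : BuchiGame V} {v : V} (h : G.InWin v) :
    ∃ Z r, Z v ∧ G.IsRanked Z r := by
  obtain ⟨Y, hY, hv⟩ := h
  let A : ℕ → V → Prop := fun n => n.rec (fun _ => False) fun _ => G.inner Y
  have hsucc : ∀ n z, A (n + 1) z ↔ G.inner Y (A n) z := fun n z => Iff.rfl
  have hmono : ∀ n z, A n z → A (n + 1) z := by
    intro n
    induction n with
    | zero => exact fun z hz => hz.elim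
    | succ n ih =>
      intro z hz
      exact ((hsucc n z).1 hz).imp_right (And.imp_right (Step.mono ih))
  have hle : ∀ z, Monotone fun n => A n z := fun z => monotone_nat_of_le_succ fun n => hmono n z
  have hpre : ∀ z, G.inner Y (fun u => ∃ n, A n u) z → ∃ n, A n z := by
    rintro z (h | ⟨hF, ⟨h0, u, hu, n, hn⟩ | ⟨h1, H⟩⟩)
    · exact ⟨1, Or.inl h⟩
    · exact ⟨n + 1, Or.inr ⟨hF, Or.inl ⟨h0, u, hu, hn⟩⟩⟩
    · -- Finitely many successors have a common stage.
      choose! n hn using H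
      obtain ⟨N, hN⟩ := (Set.finite_range n).bddAbove
      exact ⟨N + 1, Or.inr ⟨hF, Or.inr ⟨h1, fun u hu => hle u (hN ⟨u, rfl⟩) (hn u hu)⟩⟩⟩
  have hYA : ∀ y, Y y → ∃ n, A n y := fun y hy => hY y hy _ hpre
  let r : V → ℕ := fun z => sInf {n | A n z}
  have hr : ∀ z, (∃ n, A n z) → A (r z) z := fun z hz => Nat.sInf_mem (s := {n | A n z}) hz
  -- Stage `0` is empty, so `z` enters at a successor stage, by a step into the previous stage.
  have hkey : ∀ z, (∃ n, A n z) → G.Step (fun u => (∃ n, A n u) ∧ (z ∉ G.F → r u < r z)) z := by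
    intro z hz
    have h := hr z hz
    rcases hk : r z with _ | k
    · rw [hk] at h; exact h.elim
    · rw [hk, hsucc] at h
      rcases h with ⟨hF, h⟩ | ⟨-, h⟩
      · exact h.mono fun u hu => ⟨hYA u hu, fun h => (h hF).elim⟩
      · exact h.mono fun u hu => ⟨⟨k, hu⟩, fun _ => Nat.lt_succ_of_le (Nat.sInf_le hu)⟩
  refine ⟨fun z => ∃ n, A n z, r, hYA v hv, fun z hz h0 => ?_, fun z hz h1 => ?_⟩
  · exact (hkey z hz).elim And.right fun h => (G.not_mem_V1 h0 h.1).elim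
  · exact (hkey z hz).elim (fun h => (G.not_mem_V1 h.1 h1).elim) And.right

/-- Player 0 wins from a ranked set with the positional strategy given by the rank. -/
theorem IsRanked.winsFrom {G : BuchiGame V} {Z : V → Prop} {r : V → ℕ} (h : G.IsRanked Z r)
    {v : V} (hv : Z v) : G.WinsFrom v := by
  choose! σ hσE hσZ hσr using h.exists_move
  let M : V → V → Prop := fun a b => (a, b) ∈ G.E ∧ (a ∈ G.V0 → b = σ a)
  have hM : ∀ a b, Z a → M a b → Z b ∧ (a ∉ G.F → r b < r a) := by
    rintro a b ha ⟨hab, hb⟩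
    rcases G.mem_V0_or_mem_V1 a with h0 | h1
    · rw [hb h0]; exact ⟨hσZ a ha h0, hσr a ha h0⟩
    · exact h.all_moves a ha h1 b hab
  have hlast : ∀ (ρ : List V) (a : V), (ρ ++ [a]).head? = some v → (ρ ++ [a]).IsChain M →
      Z a := by
    intro ρ
    induction ρ using List.reverseRecOn with
    | nil => intro a ha _; simp at ha; exact ha ▸ hv
    | append_singleton ρ b ih =>
      intro a ha hc
      have hc' := List.isChain_append.1 hc
      refine (hM b a (ih b ?_ hc'.1) (hc'.2.2 b (by simp) a (by simp))).1
      simpa using ha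
  have hext : ∀ (ρ : List V) (a w : V), (ρ ++ [a, w]).IsChain M ↔
      (ρ ++ [a]).IsChain M ∧ M a w := by
    intro ρ a w
    rw [show ρ ++ [a, w] = (ρ ++ [a]) ++ [w] by simp, List.isChain_append]
    simp
  have hhead : ∀ (ρ : List V) (a w : V), (ρ ++ [a, w]).head? = (ρ ++ [a]).head? := by
    rintro (_ | ⟨b, ρ⟩) a w <;> rfl
  refine ⟨{ρ | ρ.head? = some v ∧ ρ.IsChain M}, ⟨by simp, ?_, ?_, ?_, ?_⟩, ?_⟩
  · rintro ρ ⟨h1, h2⟩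
    exact ⟨h1, h2.imp fun _ _ h => h.1⟩
  · rintro ρ w hρ ⟨h1, h2⟩
    refine ⟨?_, (List.isChain_append.1 h2).1⟩
    rwa [List.head?_append_of_ne_nil _ hρ] at h1
  · rintro ρ a ⟨h1, h2⟩ h0
    have ha := hlast ρ a h1 h2
    refine ⟨σ a, ⟨hσE a ha h0, (hhead ρ a _).trans h1, (hext ρ a _).2 ⟨h2, hσE a ha h0, ?_⟩⟩, ?_⟩
    · exact fun _ => rfl
    · rintro w ⟨_, _, hw⟩
      exact ((hext ρ a w).1 hw).2.2 h0
  · rintro ρ a ⟨h1, h2⟩ ha w hw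
    exact ⟨(hhead ρ a w).trans h1, (hext ρ a w).2 ⟨h2, hw, fun h0 => (G.not_mem_V1 h0 ha).elim⟩⟩
  · intro play hplay
    have hmap : ∀ n, (List.range (n + 1)).map play = (List.range n).map play ++ [play n] := by
      intro n; simp [List.range_succ]
    have hZ : ∀ n, Z (play n) := fun n =>
      hlast ((List.range n).map play) (play n) (hmap n ▸ (hplay n).1) (hmap n ▸ (hplay n).2)
    have hmove : ∀ n, M (play n) (play (n + 1)) := by
      intro n
      have := (hplay (n + 1)).2
      rw [hmap (n + 1), hmap n, List.append_assoc] at this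
      exact ((hext _ _ _).1 this).2
    rw [Filter.Frequently, Filter.eventually_atTop]
    rintro ⟨N, hN⟩
    -- Otherwise the rank decreases forever.
    have hdec : ∀ n, r (play (N + n)) + n ≤ r (play N) := by
      intro n
      induction n with
      | zero => simp
      | succ n ih =>
        have := (hM _ _ (hZ (N + n)) (hmove (N + n))).2 (hN _ (Nat.le_add_right _ _))
        rw [← Nat.add_assoc N n 1]
        omega
    have := hdec (r (play N) + 1)
    omega

/-- In a strategy tree, a node property that can always be passed on to some child forces an
infinite play all of whose later positions are last positions of nodes with this property. -/
theorem IsStrategy.exists_play {G : BuchiGame V} {v : V} {W : Set (List V)}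
    (hW : G.IsStrategy v W) {B : V → Prop}
    (hB : ∀ ρ a, ρ ++ [a] ∈ W → B a → ∃ w, ρ ++ [a, w] ∈ W ∧ B w)
    {ρ : List V} {a : V} (hρ : ρ ++ [a] ∈ W) (ha : B a) :
    ∃ play : ℕ → V, (∀ n, (List.range (n + 1)).map play ∈ W) ∧ ∀ n, B (play (ρ.length + n)) := by
  let N := {p : List V × V // p.1 ++ [p.2] ∈ W ∧ B p.2}
  have hnext : ∀ p : N, ∃ q : N, q.1.1 = p.1.1 ++ [p.1.2] := by
    rintro ⟨⟨τ, b⟩, hτ, hb⟩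
    obtain ⟨w, hw, hBw⟩ := hB τ b hτ hb
    exact ⟨⟨(τ ++ [b], w), by simpa using hw, hBw⟩, rfl⟩
  choose next hnext using hnext
  let node : ℕ → N := fun n => n.rec ⟨(ρ, a), hρ, ha⟩ fun _ => next
  have hnode : ∀ n, (node (n + 1)).1.1 = (node n).1.1 ++ [(node n).1.2] := fun n => hnext _
  -- The play passes through `ρ` and then through the last positions of the chosen nodes.
  let play : ℕ → V := fun n => if h : n < ρ.length then ρ[n] else (node (n - ρ.length)).1.2
  have hpre : ∀ n, (List.range (ρ.length + n)).map play = (node n).1.1 := by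
    intro n
    induction n with
    | zero =>
      refine List.ext_getElem (by simp [node]) fun i h1 h2 => ?_
      have hi : i < ρ.length := by simpa using h1
      simp [play, node, hi]
    | succ n ih =>
      rw [← Nat.add_assoc, List.range_succ, List.map_append, ih, hnode]
      simp [play]
  have hmem : ∀ n, (List.range (ρ.length + n + 1)).map play ∈ W := by
    intro n
    have := (node n).2.1
    rw [← hpre n] at this
    rw [List.range_succ, List.map_append]
    simpa [play] using this
  refine ⟨play, fun n => ?_, fun n => ?_⟩
  · have hdown : ∀ k, (List.range (n + k + 1)).map play ∈ W →
        (List.range (n + 1)).map play ∈ W := by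
      intro k
      induction k with
      | zero => exact id
      | succ k ih =>
        intro h
        refine ih (hW.prefix_closed _ (play (n + k + 1)) (by simp) ?_)
        rw [← Nat.add_assoc n k 1, List.range_succ, List.map_append] at h
        exact h
    refine hdown ρ.length ?_
    rw [Nat.add_comm n]
    exact hmem n
  · simpa [play] using (node n).2.2

/-- The positions visited by a winning strategy tree form a post-fixed point of the outer
operator. -/
theorem WinsFrom.inWin {G : BuchiGame V} {v : V} (h : G.WinsFrom v) : G.InWin v := by
  obtain ⟨W, hW, hwin⟩ := h
  refine ⟨fun y => ∃ ρ, ρ ++ [y] ∈ W, ?_, [], hW.root_mem⟩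
  rintro y ⟨ρ, hρ⟩ Z hZ
  by_contra hy
  -- A position of the tree outside `Z` is not in `F` and has a child outside `Z`.
  have hstep : ∀ ρ a, ρ ++ [a] ∈ W → ¬ Z a → a ∉ G.F ∧ ∃ w, ρ ++ [a, w] ∈ W ∧ ¬ Z w := by
    intro ρ a hρ ha
    have ha' := fun h => ha (hZ a h)
    have hchild : ∀ w, ρ ++ [a, w] ∈ W → ∃ τ, τ ++ [w] ∈ W := fun w hw =>
      ⟨ρ ++ [a], by simpa using hw⟩
    rcases G.mem_V0_or_mem_V1 a with h0 | h1
    · obtain ⟨w, ⟨hE, hw⟩, -⟩ := hW.unique_choice ρ a hρ h0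
      have hF : a ∉ G.F := fun hF => ha' (Or.inl ⟨hF, Or.inl ⟨h0, w, hE, hchild w hw⟩⟩)
      exact ⟨hF, w, hw, fun hZw => ha' (Or.inr ⟨hF, Or.inl ⟨h0, w, hE, hZw⟩⟩)⟩
    · have hall := hW.all_moves ρ a hρ h1
      have hF : a ∉ G.F := fun hF =>
        ha' (Or.inl ⟨hF, Or.inr ⟨h1, fun w hE => hchild w (hall w hE)⟩⟩)
      refine ⟨hF, ?_⟩
      by_contra! hno
      exact ha' (Or.inr ⟨hF, Or.inr ⟨h1, fun w hE => hno w (hall w hE)⟩⟩)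
  obtain ⟨play, hplay, hF⟩ := hW.exists_play (B := fun a => ¬ Z a ∧ a ∉ G.F)
    (fun ρ a hρ ha => by
      obtain ⟨-, w, hw, hZw⟩ := hstep ρ a hρ ha.1
      exact ⟨w, hw, hZw, (hstep (ρ ++ [a]) w (by simpa using hw) hZw).1⟩)
    hρ ⟨hy, (hstep ρ y hρ hy).1⟩
  refine hwin play hplay (Filter.eventually_atTop.2 ⟨ρ.length, fun n hn => ?_⟩)
  obtain ⟨k, rfl⟩ := Nat.exists_eq_add_of_le hn
  exact (hF k).2

/-- `winFormula` defines the winning region of Player 0. -/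
theorem winsFrom_iff_holds [Finite V] (G : BuchiGame V) (g : ℕ → V → Prop) (v : V) :
    G.WinsFrom v ↔ winFormula.Holds G.classicalInterp g (fun _ => v) := by
  rw [holds_winFormula_iff]
  refine ⟨WinsFrom.inWin, fun h => ?_⟩
  obtain ⟨Z, r, hv, hZ⟩ := h.exists_isRanked
  exact hZ.winsFrom hv

end BuchiGame

/-! ### Repairs -/

namespace BuchiGame

variable {V : Type*} {G : BuchiGame V} {Em Ep : Set (V × V)}

/-- The indeterminates of the edges in `E` and the dual ones of the edges not in `E`. -/
def trueVars (Em Ep E : Set (V × V)) : Set (↥(Em ∪ Ep) ⊕ ↥(Em ∪ Ep)) :=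
  Sum.inl '' {e | e.1 ∈ E} ∪ Sum.inr '' {e | e.1 ∉ E}

theorem inl_mem_trueVars {E : Set (V × V)} {e : ↥(Em ∪ Ep)} :
    Sum.inl e ∈ trueVars Em Ep E ↔ e.1 ∈ E := by
  simp [trueVars]

theorem inr_mem_trueVars {E : Set (V × V)} {e : ↥(Em ∪ Ep)} :
    Sum.inr e ∈ trueVars Em Ep E ↔ e.1 ∉ E := by
  simp [trueVars]

theorem consistent_infty_trueVars (Em Ep E : Set (V × V)) :
    DualAbsPoly.Consistent (Monomial.infty (trueVars Em Ep E)) :=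
  Monomial.consistent_infty fun e h => by
    rw [inl_mem_trueVars] at h
    simpa [inr_mem_trueVars] using h

theorem mem_modify_of_notMem {R : Set (V × V)} {e : V × V} (he : e ∉ Em ∪ Ep) :
    e ∈ (G.modify Em Ep R).E ↔ e ∈ G.E := by
  simp only [Set.mem_union, not_or] at he
  simp [modify, he]

theorem mem_modify_of_mem_left (hEm : Em ⊆ G.E) (hEp : Ep ⊆ G.Eᶜ) {R : Set (V × V)} {e : V × V}
    (he : e ∈ Em) : e ∈ (G.modify Em Ep R).E ↔ e ∉ R := by
  have h : e ∉ Ep := fun h => hEp h (hEm he)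
  simp [modify, he, h, hEm he]

theorem mem_modify_of_mem_right (hEp : Ep ⊆ G.Eᶜ) {R : Set (V × V)} {e : V × V}
    (he : e ∈ Ep) : e ∈ (G.modify Em Ep R).E ↔ e ∈ R := by
  have h : e ∉ G.E := hEp he
  simp [modify, he, h]

theorem mem_edgesOf_inter_repairVars {Y : Set (↥(Em ∪ Ep) ⊕ ↥(Em ∪ Ep))} {e : V × V} :
    e ∈ edgesOf (Y ∩ repairVars Em Ep) ↔
      ∃ h : e ∈ Em ∪ Ep, (Sum.inl ⟨e, h⟩ ∈ Y ∧ e ∈ Ep) ∨ (Sum.inr ⟨e, h⟩ ∈ Y ∧ e ∈ Em) := by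
  simp [edgesOf, repairVars]

/-- If `Y` contains no complementary pair, then all its literals are true in the game modified by
the edges that `Y` mentions through `X^±`: literals outside `X^±` agree with `G`, and the absence of
the complementary literal from `Y` ensures that their edges are not modified. -/
theorem subset_trueVars_edgesOf (hEm : Em ⊆ G.E) (hEp : Ep ⊆ G.Eᶜ)
    {Y : Set (↥(Em ∪ Ep) ⊕ ↥(Em ∪ Ep))} (hY : ∀ e, Sum.inl e ∈ Y → Sum.inr e ∉ Y) :
    Y ⊆ trueVars Em Ep (G.modify Em Ep (edgesOf (Y ∩ repairVars Em Ep))).E := by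
  have hdisj : ∀ e ∈ Em, e ∉ Ep := fun e h h' => hEp h' (hEm h)
  rintro (⟨e, he⟩ | ⟨e, he⟩) hmem
  · rw [inl_mem_trueVars]
    rcases id he with h | h
    · rw [mem_modify_of_mem_left hEm hEp h, mem_edgesOf_inter_repairVars]
      rintro ⟨_, ⟨-, h'⟩ | ⟨h', -⟩⟩
      · exact hdisj e h h'
      · exact hY _ hmem h'
    · rw [mem_modify_of_mem_right hEp h, mem_edgesOf_inter_repairVars]
      exact ⟨he, Or.inl ⟨hmem, h⟩⟩
  · rw [inr_mem_trueVars]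
    rcases id he with h | h
    · rw [mem_modify_of_mem_left hEm hEp h, not_not, mem_edgesOf_inter_repairVars]
      exact ⟨he, Or.inr ⟨hmem, h⟩⟩
    · rw [mem_modify_of_mem_right hEp h, mem_edgesOf_inter_repairVars]
      rintro ⟨_, ⟨h', -⟩ | ⟨-, h'⟩⟩
      · exact hY _ h' hmem
      · exact hdisj e h' h

theorem edgesOf_subset_of_subset_trueVars (hEm : Em ⊆ G.E) (hEp : Ep ⊆ G.Eᶜ)
    {Y : Set (↥(Em ∪ Ep) ⊕ ↥(Em ∪ Ep))} {R : Set (V × V)}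
    (hY : Y ⊆ trueVars Em Ep (G.modify Em Ep R).E) :
    edgesOf (Y ∩ repairVars Em Ep) ⊆ R := by
  intro e he
  obtain ⟨he, ⟨h, hp⟩ | ⟨h, hm⟩⟩ := mem_edgesOf_inter_repairVars.1 he
  · exact (mem_modify_of_mem_right hEp hp).1 (inl_mem_trueVars.1 (hY h))
  · exact not_not.1 fun hR =>
      inr_mem_trueVars.1 (hY h) ((mem_modify_of_mem_left hEm hEp hm).2 hR)

/-- If `S` contains only true literals, then literals whose value absorbs its monomial are true.
The converse fails in general: `S` may leave the truth of a repairable edge open. -/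
theorem classicalInterp_of_subset_trueVars [Finite V] {R : Set (V × V)}
    {S : Set (↥(Em ∪ Ep) ⊕ ↥(Em ∪ Ep))} (hS : S ⊆ trueVars Em Ep (G.modify Em Ep R).E)
    (l : GameLit V) (hl : Monomial.infty S ∈ (repairInterp G Em Ep l).up) :
    (G.modify Em Ep R).classicalInterp l := by
  cases l with
  | E u w =>
    by_cases h : (u, w) ∈ Em ∪ Ep
    · simp only [repairInterp, dif_pos h, DualAbsPoly.mem_up_pos, Monomial.one_le_infty_iff] at hl
      exact inl_mem_trueVars.1 (hS hl.2)
    · by_cases hE : (u, w) ∈ G.E <;>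
        simp_all [repairInterp, DualAbsPoly.mem_up_zero, classicalInterp, mem_modify_of_notMem]
  | notE u w =>
    by_cases h : (u, w) ∈ Em ∪ Ep
    · simp only [repairInterp, dif_pos h, DualAbsPoly.mem_up_neg, Monomial.one_le_infty_iff] at hl
      exact inr_mem_trueVars.1 (hS hl.2)
    · by_cases hE : (u, w) ∈ G.E <;>
        simp_all [repairInterp, DualAbsPoly.mem_up_zero, classicalInterp, mem_modify_of_notMem]
  | _ =>
    simp only [repairInterp] at hl
    split_ifs at hl with h <;> first | exact h | exact ((DualAbsPoly.mem_up_zero _).1 hl).elim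

theorem infty_trueVars_mem_up_of_classicalInterp [Finite V] {R : Set (V × V)} (l : GameLit V)
    (hl : (G.modify Em Ep R).classicalInterp l) :
    Monomial.infty (trueVars Em Ep (G.modify Em Ep R).E) ∈ (repairInterp G Em Ep l).up := by
  have hc := consistent_infty_trueVars Em Ep (G.modify Em Ep R).E
  have h1 := (DualAbsPoly.mem_up_one _).2 hc
  cases l with
  | E u w =>
    by_cases h : (u, w) ∈ Em ∪ Ep
    · simp only [repairInterp, dif_pos h, DualAbsPoly.mem_up_pos, Monomial.one_le_infty_iff]
      exact ⟨hc, inl_mem_trueVars.2 hl⟩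
    · simpa only [repairInterp, dif_neg h, if_pos ((mem_modify_of_notMem h).1 hl)] using h1
  | notE u w =>
    by_cases h : (u, w) ∈ Em ∪ Ep
    · simp only [repairInterp, dif_pos h, DualAbsPoly.mem_up_neg, Monomial.one_le_infty_iff]
      exact ⟨hc, inr_mem_trueVars.2 hl⟩
    · have hE : (u, w) ∉ G.E := fun hE => hl ((mem_modify_of_notMem h).2 hE)
      simpa only [repairInterp, dif_neg h, if_neg hE] using h1
  | F u | V0 u | V1 u =>
    simp only [repairInterp]
    rw [if_pos]
    exacts [h1, hl]
  | notF u | notV0 u | notV1 u =>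
    simp only [repairInterp]
    rw [if_neg]
    exacts [h1, hl]

theorem infty_mem_up_winValue_iff [Fintype V] {S : Set (↥(Em ∪ Ep) ⊕ ↥(Em ∪ Ep))}
    (hS : DualAbsPoly.Consistent (Monomial.infty S)) (v : V) :
    Monomial.infty S ∈ (winValue (repairInterp G Em Ep) v).up ↔
      winFormula.Holds (fun l => Monomial.infty S ∈ (repairInterp G Em Ep l).up)
        (fun _ _ => False) (fun _ => v) := by
  rw [winValue, DualAbsPoly.mem_up_eval hS (Monomial.infty_add_self S)]
  simp only [DualAbsPoly.mem_up_zero]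

theorem isRepair_edgesOf_vars [Fintype V] (hEm : Em ⊆ G.E) (hEp : Ep ⊆ G.Eᶜ) {v : V}
    {m : Monomial (↥(Em ∪ Ep) ⊕ ↥(Em ∪ Ep))}
    (hm : m ∈ (winValue (repairInterp G Em Ep) v).monomials) :
    G.IsRepair Em Ep v (edgesOf (m.vars ∩ repairVars Em Ep)) := by
  have hvars : ∀ e, Sum.inl e ∈ m.vars → Sum.inr e ∉ m.vars := fun e h h' =>
    (hm.1 e).elim (fun h0 => h.ne' h0) fun h0 => h'.ne' h0
  refine ⟨fun e ⟨he, _⟩ => he, ?_⟩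
  have hc := Monomial.consistent_infty hvars
  have hup := DualAbsPoly.mem_up_of_le (DualAbsPoly.mem_up_of_mem_monomials hm)
    m.le_infty_vars hc
  exact (winsFrom_iff_holds _ _ v).2 (((infty_mem_up_winValue_iff hc v).1 hup).mono
    (classicalInterp_of_subset_trueVars (subset_trueVars_edgesOf hEm hEp hvars)))

theorem IsRepair.exists_monomial [Fintype V] (hEm : Em ⊆ G.E) (hEp : Ep ⊆ G.Eᶜ) {v : V}
    {R : Set (V × V)} (hR : G.IsRepair Em Ep v R) :
    ∃ m ∈ (winValue (repairInterp G Em Ep) v).monomials,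
      edgesOf (m.vars ∩ repairVars Em Ep) ⊆ R := by
  have hup := (infty_mem_up_winValue_iff (consistent_infty_trueVars Em Ep _) v).2
    (((winsFrom_iff_holds _ _ v).1 hR.2).mono infty_trueVars_mem_up_of_classicalInterp)
  obtain ⟨m, hm, hle⟩ := DualAbsPoly.exists_mem_monomials_le hup
  exact ⟨m, hm, edgesOf_subset_of_subset_trueVars hEm hEp (Monomial.vars_subset_of_le_infty hle)⟩

end BuchiGame

theorem mainTheorem6 {V : Type*} [Fintype V] (G : BuchiGame V) (v : V)
    (Em Ep : Set (V × V)) (hEm : Em ⊆ G.E) (hEp : Ep ⊆ G.Eᶜ) :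
    (∀ m ∈ (winValue (repairInterp G Em Ep) v).monomials,
      G.IsRepair Em Ep v (edgesOf (m.vars ∩ repairVars Em Ep))) ∧
    (∀ R : Set (V × V), G.IsRepair Em Ep v R →
      ∃ m ∈ (winValue (repairInterp G Em Ep) v).monomials,
        edgesOf (m.vars ∩ repairVars Em Ep) ⊆ R ∧
        (Minimal (G.IsRepair Em Ep v) R → edgesOf (m.vars ∩ repairVars Em Ep) = R)) := by
  refine ⟨fun m hm => BuchiGame.isRepair_edgesOf_vars hEm hEp hm, fun R hR => ?_⟩
  obtain ⟨m, hm, hsub⟩ := hR.exists_monomial hEm hEp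
  exact ⟨m, hm, hsub, fun hmin => hsub.antisymm
    (hmin.2 (BuchiGame.isRepair_edgesOf_vars hEm hEp hm) hsub)⟩
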